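/- All topological spaces and groups are assumed to be Hausdorff. For continuous mappings $f\colon X\to Y$ and $g\colon X\to Z$ of a space $X$ onto spaces $Y$ and $Z$, write $f\prec g$ if $g=h\circ f$ for some continuous mapping $h\colon Y\to Z$. A family $\mathcal{L}$ of continuous mappings of $X$ onto other spaces is a *strong $\sigma$-lattice* for $X$ if 1. $\mathcal{L}$ generates the topology of $X$, i.e. for every closed $F\subset X$ and $x\in X\setminus F$ there is $p\in\mathcal{L}$ with $p(x)\notin\overline{p(F)}$; 2. every finite subfamily of $\mathcal{L}$ has a lower bound in $(\mathcal{L},\prec)$; 3. for every sequence $p_0\succ p_1\succ p_2\succ\cdots$ in $\mathcal{L}$, the diagonal product $x\mapsto (p_n(x))_{n\in\omega}$, considered as a mapping onto its image in $\prod_{n\in\omega}p_n(X)$, belongs to $\mathcal{L}$ up to a homeomorphism of the image, and whenever a sequence $(x_n)_{n\in\omega}$ of points of $X$ satisfies $p_k(x_n)=p_k(x_k)$ for all $k<n$, there exists $x\in X$ such that $p_n(x)=p_n(x_n)$ for each $n\in\omega$. A *network* for a space $Y$ is a family $\mathcal{N}$ of subsets of $Y$ such that every open subset of $Y$ is a union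 of members of $\mathcal{N}$. **Theorem.** Let $K$ be a compact invariant (i.e. normal) subgroup of a topological group $G$. (a) If the quotient group $G/K$ has a strong $\sigma$-lattice consisting of continuous open homomorphisms onto topological groups with a countable network, then $G$ also has a strong $\sigma$-lattice consisting of continuous open homomorphisms onto topological groups with a countable network. (b) If the quotient group $G/K$ has a strong $\sigma$-lattice consisting of continuous open homomorphisms onto topological groups with a countable base, then $G$ also has a strong $\sigma$-lattice consisting of continuous open homomorphisms onto topological groups with a countable base. -/

import Mathlib

universe u

/-- The preorder `f ≺ g` on continuous mappings of `X` onto other spaces: `g` factors through `f`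
by a continuous mapping. -/
def MapPrec {X Y Z : Type*} [TopologicalSpace Y] [TopologicalSpace Z]
    (f : X → Y) (g : X → Z) : Prop :=
  ∃ h : Y → Z, Continuous h ∧ g = h ∘ f

/-- The diagonal product of a sequence of mappings of `X`; as a mapping onto its image it takes
values in the subspace `Set.range (diagProd p)` of the product space. -/
def diagProd {X : Type*} {Y : ℕ → Type*} (p : ∀ n, X → Y n) : X → ∀ n, Y n :=
  fun x n => p n x

/-- `p` is, up to a homeomorphism of its target, the diagonal product `q` of a sequence of mappings,
regarded as a mapping onto its image. -/
def IsCopyOfDiagProd {X Z : Type*} [TopologicalSpace Z] {Y : ℕ → Type*}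
    [∀ n, TopologicalSpace (Y n)] (p : X → Z) (q : ∀ n, X → Y n) : Prop :=
  ∃ e : Z ≃ₜ Set.range (diagProd q), ∀ x : X, (e (p x) : ∀ n, Y n) = diagProd q x

/-- A family `p i : X → Y i` of continuous onto mappings is a strong `σ`-lattice for `X`. -/
structure IsStrongSigmaLattice {X : Type*} [TopologicalSpace X] {ι : Type*} {Y : ι → Type*}
    [∀ i, TopologicalSpace (Y i)] (p : ∀ i, X → Y i) : Prop where
  continuous : ∀ i, Continuous (p i)
  surjective : ∀ i, Function.Surjective (p i)
  /-- The family generates the topology of `X`: it separates points and closed sets. -/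
  generates : ∀ (x : X) (F : Set X), IsClosed F → x ∉ F → ∃ i, p i x ∉ closure (p i '' F)
  /-- Every finite subfamily has a lower bound in the family. -/
  lower_bound : ∀ s : Finset ι, ∃ j, ∀ i ∈ s, MapPrec (p j) (p i)
  /-- The diagonal product of a decreasing sequence belongs to the family. -/
  diagonal : ∀ s : ℕ → ι, (∀ n, MapPrec (p (s (n + 1))) (p (s n))) →
    ∃ j, IsCopyOfDiagProd (p j) (fun n => p (s n))
  /-- Compatible sequences of points in the images of a decreasing sequence come from a point. -/
  complete : ∀ s : ℕ → ι, (∀ n, MapPrec (p (s (n + 1))) (p (s n))) →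
    ∀ x : ℕ → X, (∀ k n, k < n → p (s k) (x n) = p (s k) (x k)) →
      ∃ z : X, ∀ n, p (s n) z = p (s n) (x n)

/-- A space has a countable network: a countable family of (arbitrary) subsets such that every open
set is a union of members of the family. -/
def HasCountableNetwork (Y : Type*) [TopologicalSpace Y] : Prop :=
  ∃ N : Set (Set Y), N.Countable ∧
    ∀ (U : Set Y) (y : Y), IsOpen U → y ∈ U → ∃ A ∈ N, y ∈ A ∧ A ⊆ U

/-- `G` has a strong `σ`-lattice of continuous open homomorphisms onto Hausdorff topological groups
with the property `P`. Up to isomorphism every image of `G` lives in the universe of `G`. -/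
def HasStrongSigmaLatticeOfOpenHoms (G : Type u) [Group G] [TopologicalSpace G]
    (P : ∀ (Y : Type u) [TopologicalSpace Y], Prop) : Prop :=
  ∃ (ι : Type u) (Y : ι → Type u) (_ : ∀ i, Group (Y i)) (_ : ∀ i, TopologicalSpace (Y i))
    (p : ∀ i, G →* Y i),
    IsStrongSigmaLattice (fun i => (p i : G → Y i)) ∧
    ∀ i, IsTopologicalGroup (Y i) ∧ T2Space (Y i) ∧ IsOpenMap (p i) ∧ P (Y i)

/-!
An open continuous homomorphism is determined up to isomorphism by its kernel, so a strong
`σ`-lattice of open homomorphisms of `G ⧸ K` is the same thing as a family `𝓜` of closed normal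
subgroups of `G` containing `K` which is small modulo `K`, directed, closed under decreasing
countable intersections, and for which these intersections carry the right topology and satisfy the
completeness condition (`IsKernelLattice`).

Let `𝓜` be such a family for `G ⧸ K`. The lattice for `G` consists of the subgroups `N = A ⊓ M`,
where `M ∈ 𝓜` and `A` is the kernel of a continuous homomorphism `φ : G → Z` to a second-countable
Hausdorff group with `M ≤ A ⊔ K`, so that `N ⊔ K = M` (`liftedKernels`). There are enough of them
for two reasons. First, every neighbourhood of the identity in `G` contains such a kernel `A`: the
quotients `G ⧸ M` have countable networks and `K` is compact, so `G` is `ω`-narrow, and Guran's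
theorem applies (`IsOmegaNarrow.exists_isSecondCountableKernel_subset`). Secondly, given `A` and
`M₀ ∈ 𝓜` there is `M ∈ 𝓜` below `M₀` with `M ≤ A ⊔ K`: intersect members of `𝓜` which are small
modulo `K` with respect to a countable neighbourhood base in `Z`, and use that `φ '' K` is compact
(`IsKernelLattice.exists_le_sup`).

The compactness of `K` enters the remaining conditions through the properness of the map
`G ⧸ N → G ⧸ (N ⊔ K)` (`le_nhds_one_mul_of_isCompact`). It shows that the topology modulo a
decreasing intersection is generated by the quotients of the sequence, and that the injective
homomorphism `G ⧸ (A ⊓ M) → (G ⧸ M) × Z` is an embedding. Hence `G ⧸ (A ⊓ M)` has a countable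
network, or a countable base, whenever `G ⧸ M` has (`IsKernelLattice.inheritedFromProd`).
-/

open Filter Topology Pointwise Set

/-! ### Compactness modulo a compact subgroup -/

section Compactness

variable {G : Type*} [Group G] [TopologicalSpace G] [IsTopologicalGroup G]

omit [IsTopologicalGroup G] in
theorem mem_nhds_one_mul_principal {N s : Set G} :
    s ∈ 𝓝 (1 : G) * 𝓟 N ↔ ∃ V ∈ 𝓝 (1 : G), V * N ⊆ s := by
  rw [Filter.mem_mul]
  constructor
  · rintro ⟨V, hV, t, ht, h⟩
    exact ⟨V, hV, (mul_subset_mul_left (mem_principal.1 ht)).trans h⟩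
  · rintro ⟨V, hV, h⟩
    exact ⟨V, hV, N, mem_principal_self N, h⟩

omit [IsTopologicalGroup G] in
/-- For an open homomorphism with kernel `N`, the neighbourhood filter of the identity of the
target pulls back to the filter generated by the sets `V * N`. -/
theorem comap_nhds_one_of_isOpenMap {H : Type*} [Group H] [TopologicalSpace H]
    {r : G →* H} (hc : Continuous r) (ho : IsOpenMap r) :
    comap r (𝓝 1) = 𝓝 1 * 𝓟 (r.ker : Set G) := by
  ext s
  rw [mem_nhds_one_mul_principal, mem_comap]
  constructor
  · rintro ⟨W, hW, h⟩
    refine ⟨r ⁻¹' W, hc.continuousAt.preimage_mem_nhds (by simpa using hW), ?_⟩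
    rintro _ ⟨v, hv, n, hn, rfl⟩
    apply h
    have : r n = 1 := hn
    simpa [this] using hv
  · rintro ⟨V, hV, h⟩
    refine ⟨r '' V, by simpa using ho.image_mem_nhds hV, ?_⟩
    rintro x ⟨v, hv, hx⟩
    refine h ⟨v, hv, v⁻¹ * x, ?_, by simp⟩
    simp [MonoidHom.mem_ker, hx]

theorem comap_mk_nhds_one (N : Subgroup G) [N.Normal] :
    comap (QuotientGroup.mk : G → G ⧸ N) (𝓝 1) = 𝓝 1 * 𝓟 (N : Set G) := by
  have := comap_nhds_one_of_isOpenMap (r := QuotientGroup.mk' N)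
    QuotientGroup.continuous_mk QuotientGroup.isOpenMap_coe
  rwa [QuotientGroup.ker_mk'] at this

/-- A homomorphism on a quotient group is inducing as soon as the topology it induces upstairs
is the one pulled back from the quotient. -/
theorem isInducing_lift {H : Type*} [Group H] [TopologicalSpace H] [IsTopologicalGroup H]
    (N : Subgroup G) [N.Normal] (ψ : G →* H) (hN : N ≤ ψ.ker)
    (h : comap ψ (𝓝 1) = 𝓝 1 * 𝓟 (N : Set G)) :
    IsInducing (QuotientGroup.lift N ψ hN) := by
  rw [IsTopologicalGroup.isInducing_iff_nhds_one]
  apply comap_injective (QuotientGroup.mk_surjective (s := N))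
  rw [comap_mk_nhds_one, comap_comap, ← h]
  rfl

/-- If the cosets `x n * N n` decrease and `z` lies in `x n * N n * K` for every `n`, then some
point of the compact set `z * K` lies in all of the cosets. -/
theorem exists_mem_forall_inv_mul_mem {K : Subgroup G} (hK : IsCompact (K : Set G))
    {N : ℕ → Subgroup G} (hN : Antitone N) (hc : ∀ n, IsClosed (N n : Set G))
    {x : ℕ → G} (hx : ∀ n, (x n)⁻¹ * x (n + 1) ∈ N n) {z : G}
    (hz : ∀ n, ∃ k ∈ K, (x n)⁻¹ * z * k ∈ N n) :
    ∃ k ∈ K, ∀ n, (x n)⁻¹ * z * k ∈ N n := by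
  have hcl : ∀ n, IsClosed {k : G | (x n)⁻¹ * z * k ∈ N n} := fun n =>
    (hc n).preimage (continuous_const_mul ((x n)⁻¹ * z))
  -- `K` is not assumed closed, so the nested intersection is formed in the compact space `K`.
  have : CompactSpace K := isCompact_iff_compactSpace.1 hK
  obtain ⟨k, hk⟩ := IsCompact.nonempty_iInter_of_sequence_nonempty_isCompact_isClosed
    (fun n => {k : K | (x n)⁻¹ * z * k ∈ N n})
    (fun n k (hk : _ ∈ _) => by
      have := (N n).mul_mem (hx n) (hN n.le_succ hk)
      simpa [mul_assoc] using this)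
    (fun n => by obtain ⟨k, hk, h⟩ := hz n; exact ⟨⟨k, hk⟩, h⟩)
    ((hcl 0).preimage continuous_subtype_val).isCompact
    (fun n => (hcl n).preimage continuous_subtype_val)
  exact ⟨k, k.2, fun n => mem_iInter.1 hk n⟩

theorem iInf_sup_eq_of_antitone {K : Subgroup G} [K.Normal] (hK : IsCompact (K : Set G))
    {N : ℕ → Subgroup G} (hN : Antitone N) (hc : ∀ n, IsClosed (N n : Set G)) :
    (⨅ n, N n) ⊔ K = ⨅ n, N n ⊔ K := by
  refine le_antisymm (le_iInf fun n => sup_le_sup_right (iInf_le N n) K) fun z hz => ?_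
  obtain ⟨k, hk, h⟩ := exists_mem_forall_inv_mul_mem hK hN hc (x := fun _ => 1) (z := z)
    (fun n => by simp [(N n).one_mem]) (fun n => by
      obtain ⟨y, hy, k, hk, rfl⟩ := Subgroup.mem_sup_of_normal_right.1 (Subgroup.mem_iInf.1 hz n)
      exact ⟨k⁻¹, K.inv_mem hk, by simpa using hy⟩)
  refine Subgroup.mem_sup_of_normal_right.2 ⟨z * k, Subgroup.mem_iInf.2 fun n => ?_, k⁻¹,
    K.inv_mem hk, by simp⟩
  simpa using h n

/-- The map `G ⧸ N → G ⧸ (N ⊔ K)` is proper when `K` is compact: a filter that converges to the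
identity modulo `N ⊔ K`, and whose only cluster point modulo `N` within `K` is the identity,
converges to the identity modulo `N`. -/
theorem le_nhds_one_mul_of_isCompact {K N : Subgroup G} [K.Normal] [N.Normal]
    (hK : IsCompact (K : Set G)) {l : Filter G}
    (hl : l ≤ 𝓝 1 * 𝓟 ((N ⊔ K : Subgroup G) : Set G))
    (hcluster : ∀ k ∈ K, ((𝓝 k * 𝓟 (N : Set G)) ⊓ l).NeBot → k ∈ N) :
    l ≤ 𝓝 1 * 𝓟 (N : Set G) := by
  intro s hs
  obtain ⟨V, hV, hVs⟩ := mem_nhds_one_mul_principal.1 hs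
  have key : ∀ k ∈ K, ∃ O ∈ 𝓝 k, ∃ F ∈ l, (O * (N : Set G)) ∩ F ⊆ s := by
    intro k hk
    by_cases hkN : k ∈ N
    · refine ⟨(fun g => g * k⁻¹) ⁻¹' V,
        (continuous_mul_const k⁻¹).continuousAt.preimage_mem_nhds (by simpa using hV),
        univ, univ_mem, ?_⟩
      rintro _ ⟨⟨g, hg, n, hn, rfl⟩, -⟩
      exact hVs ⟨g * k⁻¹, hg, k * n, N.mul_mem hkN hn, by simp⟩
    · have h : (𝓝 k * 𝓟 (N : Set G)) ⊓ l = ⊥ := by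
        by_contra h
        exact hkN (hcluster k hk ⟨h⟩)
      obtain ⟨A, hA, F, hF, hAF⟩ := Filter.mem_inf_iff.1 (h ▸ mem_bot : (∅ : Set G) ∈ _)
      obtain ⟨O, hO, T, hT, hOT⟩ := Filter.mem_mul.1 hA
      refine ⟨O, hO, F, hF, ?_⟩
      rw [mem_principal] at hT
      rintro y ⟨hy, hyF⟩
      have : y ∈ A ∩ F := ⟨hOT (mul_subset_mul_left hT hy), hyF⟩
      rw [← hAF] at this
      exact this.elim
  choose! O hO F hF hOF using key
  obtain ⟨t, htK, ht⟩ := hK.elim_nhds_subcover (fun k => interior (O k))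
    (fun k hk => interior_mem_nhds.2 (hO k hk))
  obtain ⟨W, hW, hWK⟩ := compact_open_separated_mul_left hK
    (isOpen_biUnion fun k (_ : k ∈ t) => isOpen_interior) ht
  have h1 : (⋂ k ∈ t, F k) ∈ l := (Filter.biInter_finset_mem t).2 fun k hk => hF k (htK k hk)
  filter_upwards [h1, hl (mem_nhds_one_mul_principal.2 ⟨W, hW, Subset.rfl⟩)] with y hyF hy
  obtain ⟨w, hw, m, hm, rfl⟩ := hy
  obtain ⟨k', hk', n, hn, rfl⟩ := Subgroup.mem_sup_of_normal_right.1
    (show m ∈ K ⊔ N by rw [sup_comm]; exact hm)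
  obtain ⟨k, hkt, hwk⟩ := mem_iUnion₂.1 (hWK (mul_mem_mul hw hk'))
  refine hOF k (htK k hkt) ⟨⟨w * k', interior_subset hwk, n, hn, mul_assoc _ _ _⟩, ?_⟩
  exact mem_iInter₂.1 hyF k hkt

omit [IsTopologicalGroup G] in
theorem map_eq_one_of_neBot {H : Type*} [Group H] [TopologicalSpace H] [T2Space H]
    {r : G →* H} (hr : Continuous r) {N : Subgroup G} (hN : N ≤ r.ker) {l : Filter G}
    (hl : l ≤ comap r (𝓝 1)) {k : G} (h : ((𝓝 k * 𝓟 (N : Set G)) ⊓ l).NeBot) : r k = 1 := by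
  have h1 : 𝓝 k * 𝓟 (N : Set G) ≤ comap r (𝓝 (r k)) := by
    rintro s ⟨W, hW, hs⟩
    refine Filter.mem_mul.2 ⟨r ⁻¹' W, hr.continuousAt.preimage_mem_nhds hW, N,
      mem_principal_self _, ?_⟩
    rintro _ ⟨g, hg, n, hn, rfl⟩
    apply hs
    have hn1 : r n = 1 := hN hn
    simpa [hn1] using hg
  have h2 := h.mono (inf_le_inf h1 hl)
  rw [← comap_inf] at h2
  exact @eq_of_nhds_neBot _ _ _ _ _ (neBot_of_comap h2)

end Compactness

/-! ### Lattices of kernels -/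

/-- A family of closed normal subgroups of `G` containing `K` which are the kernels of the members
of a strong `σ`-lattice of open homomorphisms of `G ⧸ K`. An open homomorphism is determined by its
kernel up to isomorphism, and the conditions on the lattice are expressed by the kernels in `G`;
the filter `𝓝 1 * 𝓟 M` is the pullback to `G` of the neighbourhood filter of `1` in `G ⧸ M`. -/
structure IsKernelLattice {G : Type*} [Group G] [TopologicalSpace G] (K : Subgroup G)
    (𝓜 : Set (Subgroup G)) : Prop where
  normal : ∀ M ∈ 𝓜, M.Normal
  isClosed : ∀ M ∈ 𝓜, IsClosed (M : Set G)
  le : ∀ M ∈ 𝓜, K ≤ M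
  small : ∀ U ∈ 𝓝 (1 : G), ∃ M ∈ 𝓜, (M : Set G) ⊆ U * K
  directed : ∀ M₁ ∈ 𝓜, ∀ M₂ ∈ 𝓜, ∃ M ∈ 𝓜, M ≤ M₁ ∧ M ≤ M₂
  iInf_mem : ∀ M : ℕ → Subgroup G, Antitone M → (∀ n, M n ∈ 𝓜) → ⨅ n, M n ∈ 𝓜
  /-- The quotient topology modulo the intersection is generated by the quotients modulo the
  members of the sequence. -/
  nhds_iInf_le : ∀ M : ℕ → Subgroup G, Antitone M → (∀ n, M n ∈ 𝓜) →
    ⨅ n, 𝓝 1 * 𝓟 (M n : Set G) ≤ 𝓝 1 * 𝓟 ((⨅ n, M n : Subgroup G) : Set G)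
  complete : ∀ M : ℕ → Subgroup G, Antitone M → (∀ n, M n ∈ 𝓜) →
    ∀ x : ℕ → G, (∀ k n, k < n → (x k)⁻¹ * x n ∈ M k) → ∃ z, ∀ n, (x n)⁻¹ * z ∈ M n

/-- A topological property inherited by every space whose topology is induced by a mapping to the
product of a space with the property and a second-countable space. The mapping need not be
injective. -/
def InheritedFromProd (P : ∀ (Y : Type u) [TopologicalSpace Y], Prop) : Prop :=
  ∀ (X Y Z : Type u) [TopologicalSpace X] [TopologicalSpace Y] [TopologicalSpace Z]
    [SecondCountableTopology Z] (f : X → Y × Z), IsInducing f → P Y → P X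

theorem inheritedFromProd_secondCountableTopology :
    InheritedFromProd.{u} (fun Y _ => SecondCountableTopology Y) := by
  intro X Y Z _ _ _ _ f hf hY
  exact hf.secondCountableTopology

theorem inheritedFromProd_hasCountableNetwork :
    InheritedFromProd.{u} (fun Y _ => HasCountableNetwork Y) := by
  rintro X Y Z _ _ _ _ f hf ⟨N, hN, h⟩
  refine ⟨(fun q : Set Y × Set Z => f ⁻¹' (q.1 ×ˢ q.2)) ''
    (N ×ˢ TopologicalSpace.countableBasis Z),
    (hN.prod (TopologicalSpace.countable_countableBasis Z)).image _, fun U x hU hx => ?_⟩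
  obtain ⟨V, hV, rfl⟩ := hf.isOpen_iff.1 hU
  obtain ⟨A, B, hA, hB, hxA, hxB, hAB⟩ := isOpen_prod_iff.1 hV (f x).1 (f x).2 hx
  obtain ⟨A', hA', hxA', hAA'⟩ := h A _ hA hxA
  obtain ⟨B', hB', hxB', hBB'⟩ :=
    (TopologicalSpace.isBasis_countableBasis Z).exists_subset_of_mem_open hxB hB
  exact ⟨_, ⟨(A', B'), ⟨hA', hB'⟩, rfl⟩, ⟨hxA', hxB'⟩,
    preimage_mono ((prod_mono hAA' hBB').trans hAB)⟩

theorem hasCountableNetwork_of_secondCountableTopology (Y : Type*) [TopologicalSpace Y]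
    [SecondCountableTopology Y] : HasCountableNetwork Y :=
  ⟨_, TopologicalSpace.countable_countableBasis Y, fun _ _ hU hy =>
    (TopologicalSpace.isBasis_countableBasis Y).exists_subset_of_mem_open hy hU⟩

section Kernels

variable {G : Type u} [Group G] [TopologicalSpace G] [IsTopologicalGroup G]

theorem MapPrec.ker_le {H Y Z : Type*} [Group H] [Group Y] [Group Z] [TopologicalSpace Y]
    [TopologicalSpace Z] {f : H →* Y} {g : H →* Z} (h : MapPrec f g) : f.ker ≤ g.ker := by
  obtain ⟨t, -, ht⟩ := h
  intro x hx
  have hx' : f x = f 1 := by rw [map_one]; exact hx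
  rw [MonoidHom.mem_ker, ← map_one g, ht, Function.comp, Function.comp, hx']

theorem mapPrec_of_ker_le {H Y Z : Type*} [Group H] [TopologicalSpace H] [Group Y] [Group Z]
    [TopologicalSpace Y] [TopologicalSpace Z] {f : H →* Y} {g : H →* Z} (hf : Continuous f)
    (ho : IsOpenMap f) (hs : Function.Surjective f) (hg : Continuous g) (h : f.ker ≤ g.ker) :
    MapPrec f g := by
  have hgf : (g : H → Z) = (g ∘ Function.surjInv hs) ∘ f := by
    funext x
    have : x⁻¹ * Function.surjInv hs (f x) ∈ f.ker := by
      simp [MonoidHom.mem_ker, Function.surjInv_eq hs]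
    have := h this
    rw [MonoidHom.mem_ker, map_mul, map_inv, inv_mul_eq_one] at this
    exact this
  exact ⟨g ∘ Function.surjInv hs, (ho.isQuotientMap hf hs).continuous_iff.2 (hgf ▸ hg), hgf⟩

/-- The kernels in `G` of the members of a strong `σ`-lattice of open homomorphisms of `G ⧸ K` form
a lattice of kernels. -/
theorem exists_isKernelLattice (K : Subgroup G) [K.Normal]
    {P : ∀ (Y : Type u) [TopologicalSpace Y], Prop} (hP : InheritedFromProd P)
    (h : HasStrongSigmaLatticeOfOpenHoms (G ⧸ K) P) :
    ∃ 𝓜 : Set (Subgroup G), IsKernelLattice K 𝓜 ∧ ∀ M ∈ 𝓜, P (G ⧸ M) := by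
  classical
  obtain ⟨ι, Y, _, _, p, hp, hY⟩ := h
  have hT : ∀ i, IsTopologicalGroup (Y i) := fun i => (hY i).1
  have hT2 : ∀ i, T2Space (Y i) := fun i => (hY i).2.1
  let r : ∀ i, G →* Y i := fun i => (p i).comp (QuotientGroup.mk' K)
  have hrc : ∀ i, Continuous (r i) := fun i => (hp.continuous i).comp QuotientGroup.continuous_mk
  have hro : ∀ i, IsOpenMap (r i) := fun i => (hY i).2.2.1.comp QuotientGroup.isOpenMap_coe
  have hKr : ∀ i, K ≤ (r i).ker := fun i k hk => by
    simp [r, MonoidHom.mem_ker, (QuotientGroup.eq_one_iff k).2 hk]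
  have hprec : ∀ i j, (r i).ker ≤ (r j).ker → MapPrec (p i) (p j) := fun i j hij =>
    mapPrec_of_ker_le (hp.continuous i) (hY i).2.2.1 (hp.surjective i) (hp.continuous j)
      (fun x hx => by
        obtain ⟨g, rfl⟩ := QuotientGroup.mk_surjective x
        exact hij (show g ∈ (r i).ker from hx))
  have hle : ∀ i j, MapPrec (p i) (p j) → (r i).ker ≤ (r j).ker := fun i j hij g hg =>
    hij.ker_le (show (g : G ⧸ K) ∈ (p i).ker from hg)
  have hseq : ∀ M : ℕ → Subgroup G, Antitone M → (∀ n, M n ∈ range fun i => (r i).ker) →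
      ∃ s : ℕ → ι, (∀ n, (r (s n)).ker = M n) ∧ (∀ n, MapPrec (p (s (n + 1))) (p (s n))) := by
    intro M hM hMr
    choose s hs using hMr
    refine ⟨s, hs, fun n => hprec _ _ ?_⟩
    have h1 : (r (s (n + 1))).ker = M (n + 1) := hs _
    have h2 : (r (s n)).ker = M n := hs _
    rw [h1, h2]
    exact hM n.le_succ
  -- The diagonal product of a decreasing sequence is the homomorphism whose kernel is the
  -- intersection of the kernels, and its target carries the topology induced by the sequence.
  have hdiag : ∀ s : ℕ → ι, (∀ n, MapPrec (p (s (n + 1))) (p (s n))) →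
      ∃ j, (r j).ker = ⨅ n, (r (s n)).ker ∧
        comap (r j) (𝓝 1) = ⨅ n, comap (r (s n)) (𝓝 1) := by
    intro s hs
    obtain ⟨j, e, he⟩ := hp.diagonal s hs
    have hind : IsInducing (fun y => (e y : ∀ n, Y (s n))) :=
      IsInducing.subtypeVal.comp e.isInducing
    have her : ∀ g : G, (e (r j g) : ∀ n, Y (s n)) = fun n => r (s n) g := fun g => he g
    refine ⟨j, ?_, ?_⟩
    · ext g
      rw [Subgroup.mem_iInf, MonoidHom.mem_ker, ← map_one (r j), ← e.injective.eq_iff,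
        ← Subtype.val_injective.eq_iff, her, her, funext_iff]
      simp [MonoidHom.mem_ker]
    · rw [← map_one (r j), hind.nhds_eq_comap, comap_comap, her, nhds_pi, Filter.pi, comap_iInf]
      refine iInf_congr fun n => ?_
      rw [comap_comap, map_one]
      congr 1
      funext g
      exact congrFun (her g) n
  refine ⟨range fun i => (r i).ker, ⟨?_, ?_, ?_, ?_, ?_, ?_, ?_, ?_⟩, ?_⟩
  · rintro _ ⟨i, rfl⟩
    exact MonoidHom.normal_ker (r i)
  · rintro _ ⟨i, rfl⟩
    exact isClosed_singleton.preimage (hrc i)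
  · rintro _ ⟨i, rfl⟩
    exact hKr i
  · intro U hU
    have hO : IsOpen ((QuotientGroup.mk : G → G ⧸ K) '' interior U) :=
      QuotientGroup.isOpenMap_coe _ isOpen_interior
    obtain ⟨i, hi⟩ := hp.generates (1 : G ⧸ K) _ hO.isClosed_compl
      (fun h => h ⟨1, mem_interior_iff_mem_nhds.2 hU, rfl⟩)
    refine ⟨_, ⟨i, rfl⟩, fun m hm => ?_⟩
    have hm' : p i (m : G ⧸ K) = p i 1 := by rw [map_one]; exact hm
    by_contra hmU
    refine hi (subset_closure ⟨(m : G ⧸ K), fun ⟨u, hu, hum⟩ => hmU ?_, hm'⟩)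
    exact ⟨u, interior_subset hu, u⁻¹ * m, QuotientGroup.eq.1 hum, by simp⟩
  · rintro _ ⟨i, rfl⟩ _ ⟨j, rfl⟩
    obtain ⟨k, hk⟩ := hp.lower_bound {i, j}
    exact ⟨_, ⟨k, rfl⟩, hle _ _ (hk i (by simp)), hle _ _ (hk j (by simp))⟩
  · intro M hM hMr
    obtain ⟨s, hs, hsp⟩ := hseq M hM hMr
    obtain ⟨j, hj, -⟩ := hdiag s hsp
    exact ⟨j, by simp only [hj, hs]⟩
  · intro M hM hMr
    obtain ⟨s, hs, hsp⟩ := hseq M hM hMr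
    obtain ⟨j, hj, hj'⟩ := hdiag s hsp
    simp only [comap_nhds_one_of_isOpenMap (hrc _) (hro _), hj, hs] at hj'
    exact hj'.ge
  · intro M hM hMr x hx
    obtain ⟨s, hs, hsp⟩ := hseq M hM hMr
    have hmem : ∀ n (a b : G), a⁻¹ * b ∈ M n ↔ p (s n) (b : G ⧸ K) = p (s n) (a : G ⧸ K) := by
      intro n a b
      rw [← hs n, MonoidHom.mem_ker, map_mul, map_inv, inv_mul_eq_one, eq_comm]
      rfl
    obtain ⟨z, hz⟩ := hp.complete s hsp (fun n => (x n : G ⧸ K))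
      (fun k n hkn => (hmem k _ _).1 (hx k n hkn))
    obtain ⟨z, rfl⟩ := QuotientGroup.mk_surjective z
    exact ⟨z, fun n => (hmem n _ _).2 (hz n)⟩
  · rintro _ ⟨i, rfl⟩
    exact hP _ (Y i) PUnit _ ((Homeomorph.prodPUnit (Y i)).symm.isInducing.comp
      (isInducing_lift (r i).ker (r i) le_rfl (comap_nhds_one_of_isOpenMap (hrc i) (hro i))))
      (hY i).2.2.2

/-- The quotient homomorphisms by the members of a lattice of kernels (with `K` trivial) form a
strong `σ`-lattice. -/
theorem IsKernelLattice.hasStrongSigmaLatticeOfOpenHoms {𝓝' : Set (Subgroup G)}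
    (h : IsKernelLattice ⊥ 𝓝') {P : ∀ (Y : Type u) [TopologicalSpace Y], Prop}
    (hP : ∀ N ∈ 𝓝', P (G ⧸ N)) : HasStrongSigmaLatticeOfOpenHoms G P := by
  classical
  have hn : ∀ N : 𝓝', (N : Subgroup G).Normal := fun N => h.normal N N.2
  have hcl : ∀ N : 𝓝', IsClosed ((N : Subgroup G) : Set G) := fun N => h.isClosed N N.2
  have hprec : ∀ N N' : 𝓝', N.1 ≤ N'.1 →
      MapPrec (QuotientGroup.mk' N.1) (QuotientGroup.mk' N'.1) := fun N N' hNN' =>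
    mapPrec_of_ker_le QuotientGroup.continuous_mk QuotientGroup.isOpenMap_coe
      (QuotientGroup.mk'_surjective _) QuotientGroup.continuous_mk (by simpa using hNN')
  have hanti : ∀ s : ℕ → 𝓝', (∀ n, MapPrec (QuotientGroup.mk' (s (n + 1)).1)
      (QuotientGroup.mk' (s n).1)) → Antitone fun n => (s n).1 := fun s hs =>
    antitone_nat_of_succ_le fun n => by simpa using (hs n).ker_le
  refine ⟨𝓝', fun N => G ⧸ N.1, fun N => inferInstance, fun N => inferInstance,
    fun N => QuotientGroup.mk' N.1, ⟨fun N => QuotientGroup.continuous_mk,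
      fun N => QuotientGroup.mk'_surjective _, ?_, ?_, ?_, ?_⟩,
    fun N => ⟨inferInstance, inferInstance, QuotientGroup.isOpenMap_coe, hP N N.2⟩⟩
  · intro x F hF hx
    have hU : (fun g => x * g) ⁻¹' Fᶜ ∈ 𝓝 (1 : G) :=
      (continuous_const_mul x).continuousAt.preimage_mem_nhds
        (hF.isOpen_compl.mem_nhds (by simpa using hx))
    obtain ⟨V, hVo, hV1, hVV⟩ := exists_open_nhds_one_mul_subset hU
    obtain ⟨N, hN, hNV⟩ := h.small V (hVo.mem_nhds hV1)
    refine ⟨⟨N, hN⟩, fun hcl => ?_⟩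
    have hO : IsOpen ((QuotientGroup.mk : G → G ⧸ N) '' ((fun g => x * g) '' V)) :=
      QuotientGroup.isOpenMap_coe _ (isOpenMap_mul_left x V hVo)
    obtain ⟨_, ⟨_, ⟨v, hv, rfl⟩, hvf⟩, f, hf, rfl⟩ :=
      mem_closure_iff.1 hcl _ hO ⟨x, ⟨1, hV1, mul_one x⟩, rfl⟩
    have hm : (x * v)⁻¹ * f ∈ N := QuotientGroup.eq.1 hvf
    have hmV : (x * v)⁻¹ * f ∈ V := by simpa using hNV hm
    have := hVV (mul_mem_mul hv hmV)
    simp only [mem_preimage] at this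
    apply this
    convert hf using 1
    group
  · intro s
    obtain ⟨N₀, hN₀, -⟩ := h.small univ univ_mem
    suffices ∃ j : 𝓝', ∀ i ∈ s, j.1 ≤ i.1 by
      obtain ⟨j, hj⟩ := this
      exact ⟨j, fun i hi => hprec _ _ (hj i hi)⟩
    induction s using Finset.induction_on with
    | empty => exact ⟨⟨N₀, hN₀⟩, by simp⟩
    | insert a s _ ih =>
      obtain ⟨j, hj⟩ := ih
      obtain ⟨N, hN, hNa, hNj⟩ := h.directed a a.2 j j.2
      exact ⟨⟨N, hN⟩, fun i hi => (Finset.mem_insert.1 hi).elim (fun e => e ▸ hNa)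
        fun hi => hNj.trans (hj i hi)⟩
  · intro s hs
    have hs' := hanti s hs
    have hmem := h.iInf_mem _ hs' fun n => (s n).2
    refine ⟨⟨_, hmem⟩, ?_⟩
    have hnor : (⨅ n, (s n).1).Normal := h.normal _ hmem
    have hclN : IsClosed ((⨅ n, (s n).1 : Subgroup G) : Set G) := h.isClosed _ hmem
    let ψ : G →* ∀ n, G ⧸ (s n).1 := MonoidHom.mk' (fun g n => (g : G ⧸ (s n).1)) fun _ _ => rfl
    have hker : (⨅ n, (s n).1) ≤ ψ.ker := fun g hg => by
      rw [MonoidHom.mem_ker]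
      funext n
      exact (QuotientGroup.eq_one_iff g).2 (Subgroup.mem_iInf.1 hg n)
    have hψ : IsInducing (QuotientGroup.lift _ ψ hker) := by
      apply isInducing_lift
      have : comap ψ (𝓝 1) = ⨅ n, 𝓝 1 * 𝓟 ((s n).1 : Set G) := by
        rw [nhds_pi, Filter.pi, comap_iInf]
        refine iInf_congr fun n => ?_
        rw [comap_comap, ← comap_mk_nhds_one]
        rfl
      rw [this]
      refine le_antisymm (h.nhds_iInf_le _ hs' fun n => (s n).2) (le_iInf fun n => ?_)
      exact mul_le_mul' le_rfl (principal_mono.2 (iInf_le (fun n => (s n).1) n))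
    have hrange : range (QuotientGroup.lift _ ψ hker) =
        range (diagProd fun n => (QuotientGroup.mk' (s n).1 : G → G ⧸ (s n).1)) := by
      rw [← (QuotientGroup.mk_surjective (s := ⨅ n, (s n).1)).range_comp]
      rfl
    exact ⟨hψ.isEmbedding.toHomeomorph.trans (Homeomorph.setCongr hrange), fun x => rfl⟩
  · intro s hs x hx
    obtain ⟨z, hz⟩ := h.complete _ (hanti s hs) (fun n => (s n).2) x
      (fun k n hkn => QuotientGroup.eq.1 (hx k n hkn).symm)
    exact ⟨z, fun n => (QuotientGroup.eq.2 (hz n)).symm⟩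

end Kernels

/-! ### Lifting a lattice of kernels along a compact normal subgroup -/

section Lift

variable {G : Type u} [Group G] [TopologicalSpace G]

/-- `A` is the kernel of a continuous homomorphism to a second-countable Hausdorff group. The
homomorphism need not be open, so the quotient `G ⧸ A` itself need not be second-countable. -/
def IsSecondCountableKernel (A : Subgroup G) : Prop :=
  ∃ (Z : Type u) (_ : Group Z) (_ : TopologicalSpace Z) (φ : G →* Z), IsTopologicalGroup Z ∧
    T2Space Z ∧ SecondCountableTopology Z ∧ Continuous φ ∧ φ.ker = A

theorem IsSecondCountableKernel.inf {A B : Subgroup G} (hA : IsSecondCountableKernel A)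
    (hB : IsSecondCountableKernel B) : IsSecondCountableKernel (A ⊓ B) := by
  obtain ⟨Y, _, _, φ, _, _, _, hφ, rfl⟩ := hA
  obtain ⟨Z, _, _, ψ, _, _, _, hψ, rfl⟩ := hB
  exact ⟨Y × Z, inferInstance, inferInstance, φ.prod ψ, inferInstance, inferInstance,
    inferInstance, hφ.prodMk hψ, MonoidHom.ker_prod φ ψ⟩

theorem IsSecondCountableKernel.iInf {A : ℕ → Subgroup G}
    (hA : ∀ n, IsSecondCountableKernel (A n)) : IsSecondCountableKernel (⨅ n, A n) := by
  choose Z _ _ φ hZ hT hS hφ hker using hA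
  refine ⟨∀ n, Z n, inferInstance, inferInstance, MonoidHom.mk' (fun g n => φ n g) fun a b => ?_,
    inferInstance, inferInstance, inferInstance, continuous_pi hφ, ?_⟩
  · funext n
    exact map_mul (φ n) a b
  · ext g
    simp only [Subgroup.mem_iInf, ← hker, MonoidHom.mem_ker, MonoidHom.mk'_apply]
    exact funext_iff

theorem IsSecondCountableKernel.normal {A : Subgroup G} (hA : IsSecondCountableKernel A) :
    A.Normal := by
  obtain ⟨Z, _, _, φ, _, _, _, hφ, rfl⟩ := hA
  exact MonoidHom.normal_ker φ

theorem IsSecondCountableKernel.isClosed {A : Subgroup G} (hA : IsSecondCountableKernel A) :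
    IsClosed (A : Set G) := by
  obtain ⟨Z, _, _, φ, _, _, _, hφ, rfl⟩ := hA
  exact isClosed_singleton.preimage hφ

theorem IsKernelLattice.exists_antitone_le {K : Subgroup G} {𝓜 : Set (Subgroup G)}
    (h : IsKernelLattice K 𝓜) (M : ℕ → Subgroup G) (hM : ∀ n, M n ∈ 𝓜) :
    ∃ L : ℕ → Subgroup G, Antitone L ∧ (∀ n, L n ∈ 𝓜) ∧ ∀ n, L n ≤ M n := by
  choose! f hf hf₁ hf₂ using h.directed
  let L : ℕ → Subgroup G := fun n => Nat.rec (M 0) (fun n L => f L (M (n + 1))) n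
  have hL : ∀ n, L n ∈ 𝓜 := fun n => by
    induction n with
    | zero => exact hM 0
    | succ n ih => exact hf _ ih _ (hM _)
  refine ⟨L, antitone_nat_of_succ_le fun n => hf₁ _ (hL n) _ (hM _), hL, fun n => ?_⟩
  cases n with
  | zero => exact le_rfl
  | succ n => exact hf₂ _ (hL n) _ (hM _)

/-- Continuous homomorphisms of `G ⧸ K` to second-countable groups factor through members of the
lattice. -/
theorem IsKernelLattice.exists_le_sup {K : Subgroup G} [K.Normal] (hK : IsCompact (K : Set G))
    {𝓜 : Set (Subgroup G)} (h : IsKernelLattice K 𝓜) {A : Subgroup G}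
    (hA : IsSecondCountableKernel A) {M₀ : Subgroup G} (hM₀ : M₀ ∈ 𝓜) :
    ∃ M ∈ 𝓜, M ≤ M₀ ∧ M ≤ A ⊔ K := by
  obtain ⟨Z, _, _, φ, _, _, _, hφ, rfl⟩ := hA
  obtain ⟨W, hW⟩ := (𝓝 (1 : Z)).exists_antitone_basis
  have hsmall : ∀ n, ∃ M ∈ 𝓜, M ≤ M₀ ∧ (M : Set G) ⊆ φ ⁻¹' W n * K := fun n => by
    obtain ⟨M, hM, hMW⟩ := h.small (φ ⁻¹' W n)
      (hφ.continuousAt.preimage_mem_nhds (by simpa using hW.mem n))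
    obtain ⟨L, hL, hLM, hL₀⟩ := h.directed M hM M₀ hM₀
    exact ⟨L, hL, hL₀, fun x hx => hMW (hLM hx)⟩
  choose M hM hMM₀ hMW using hsmall
  obtain ⟨L, hL, hL𝓜, hLM⟩ := h.exists_antitone_le M hM
  refine ⟨⨅ n, L n, h.iInf_mem L hL hL𝓜, (iInf_le L 0).trans ((hLM 0).trans (hMM₀ 0)),
    fun g hg => ?_⟩
  -- `φ g` is arbitrarily close to the compact set `φ '' K`, hence belongs to it.
  have hcl : IsClosed ((fun y => φ g * y⁻¹) '' (φ '' K)) :=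
    ((hK.image hφ).image (by fun_prop)).isClosed
  have h1 : (1 : Z) ∈ (fun y => φ g * y⁻¹) '' (φ '' K) := by
    rw [← hcl.closure_eq, mem_closure_iff_nhds_basis hW.1]
    intro n _
    obtain ⟨w, hw, k, hk, hwk⟩ := hMW n (hLM n (Subgroup.mem_iInf.1 hg n))
    exact ⟨φ w, ⟨φ k, ⟨k, hk, rfl⟩, by simp [← hwk]⟩, hw⟩
  obtain ⟨_, ⟨k, hk, rfl⟩, hgk⟩ := h1
  exact Subgroup.mem_sup_of_normal_right.2 ⟨g * k⁻¹, by simpa [MonoidHom.mem_ker] using hgk, k, hk,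
    by simp⟩

/-- The lattice of kernels in `G` obtained from the lattice `𝓜` of kernels modulo `K`: its members
are the subgroups `A ⊓ M` with `M ∈ 𝓜` and `A` the kernel of a homomorphism to a second-countable
group for which `M` is recovered as `(A ⊓ M) ⊔ K`. -/
def liftedKernels (K : Subgroup G) (𝓜 : Set (Subgroup G)) : Set (Subgroup G) :=
  {N | N ⊔ K ∈ 𝓜 ∧ ∃ A, IsSecondCountableKernel A ∧ N = A ⊓ (N ⊔ K)}

theorem IsKernelLattice.exists_mem_liftedKernels {K : Subgroup G} [K.Normal]
    (hK : IsCompact (K : Set G)) {𝓜 : Set (Subgroup G)} (h : IsKernelLattice K 𝓜)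
    {A : Subgroup G} (hA : IsSecondCountableKernel A) {M₀ : Subgroup G} (hM₀ : M₀ ∈ 𝓜) :
    ∃ N ∈ liftedKernels K 𝓜, N ≤ A ∧ N ≤ M₀ := by
  obtain ⟨M, hM, hMM₀, hMA⟩ := h.exists_le_sup hK hA hM₀
  have hsup : A ⊓ M ⊔ K = M := by
    refine le_antisymm (sup_le inf_le_right (h.le M hM)) fun m hm => ?_
    obtain ⟨a, ha, k, hk, rfl⟩ := Subgroup.mem_sup_of_normal_right.1 (hMA hm)
    refine Subgroup.mem_sup_of_normal_right.2 ⟨a, ⟨ha, ?_⟩, k, hk, rfl⟩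
    simpa using M.mul_mem hm (M.inv_mem (h.le M hM hk))
  exact ⟨A ⊓ M, ⟨hsup.symm ▸ hM, A, hA, by rw [hsup]⟩, inf_le_left, inf_le_right.trans hMM₀⟩

variable [IsTopologicalGroup G]

theorem isKernelLattice_liftedKernels {K : Subgroup G} [K.Normal]
    (hK : IsCompact (K : Set G)) {𝓜 : Set (Subgroup G)} (h : IsKernelLattice K 𝓜)
    (hA : ∀ U ∈ 𝓝 (1 : G), ∃ A : Subgroup G, IsSecondCountableKernel A ∧ (A : Set G) ⊆ U) :
    IsKernelLattice ⊥ (liftedKernels K 𝓜) := by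
  have hnor : ∀ N ∈ liftedKernels K 𝓜, N.Normal := by
    rintro N ⟨hM, A, hA, hN⟩
    have := hA.normal
    have := h.normal _ hM
    rw [hN]
    infer_instance
  have hcl : ∀ N ∈ liftedKernels K 𝓜, IsClosed (N : Set G) := by
    rintro N ⟨hM, A, hA, hN⟩
    rw [hN]
    exact hA.isClosed.inter (h.isClosed _ hM)
  have hanti : ∀ N : ℕ → Subgroup G, Antitone N → Antitone fun n => N n ⊔ K :=
    fun N hN m n hmn => sup_le_sup_right (hN hmn) K
  have hmem : ∀ N : ℕ → Subgroup G, Antitone N → (∀ n, N n ∈ liftedKernels K 𝓜) →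
      ⨅ n, N n ∈ liftedKernels K 𝓜 := by
    intro N hN hN𝓝
    have hsup := iInf_sup_eq_of_antitone hK hN fun n => hcl _ (hN𝓝 n)
    choose hM A hA hNA using hN𝓝
    refine ⟨hsup ▸ h.iInf_mem _ (hanti N hN) hM, ⨅ n, A n, .iInf hA, ?_⟩
    rw [hsup, ← iInf_inf_eq]
    exact iInf_congr hNA
  obtain ⟨M₀, hM₀, -⟩ := h.small univ univ_mem
  refine ⟨hnor, hcl, fun _ _ => bot_le, ?_, ?_, hmem, ?_, ?_⟩
  · intro U hU
    obtain ⟨A, hA, hAU⟩ := hA U hU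
    obtain ⟨N, hN, hNA, -⟩ := h.exists_mem_liftedKernels hK hA hM₀
    exact ⟨N, hN, fun x hx => by simpa using hAU (hNA hx)⟩
  · rintro N₁ ⟨hM₁, A₁, hA₁, hN₁⟩ N₂ ⟨hM₂, A₂, hA₂, hN₂⟩
    obtain ⟨M, hM, hMM₁, hMM₂⟩ := h.directed _ hM₁ _ hM₂
    obtain ⟨N, hN, hNA, hNM⟩ := h.exists_mem_liftedKernels hK (hA₁.inf hA₂) hM
    refine ⟨N, hN, ?_, ?_⟩
    · rw [hN₁]
      exact le_inf (hNA.trans inf_le_left) (hNM.trans hMM₁)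
    · rw [hN₂]
      exact le_inf (hNA.trans inf_le_right) (hNM.trans hMM₂)
  · intro N hN hN𝓝
    have := hnor _ (hmem N hN hN𝓝)
    apply le_nhds_one_mul_of_isCompact hK
    · rw [iInf_sup_eq_of_antitone hK hN fun n => hcl _ (hN𝓝 n)]
      refine le_trans (iInf_mono fun n => ?_) (h.nhds_iInf_le _ (hanti N hN) fun n => (hN𝓝 n).1)
      exact mul_le_mul' le_rfl (principal_mono.2 (le_sup_left : N n ≤ N n ⊔ K))
    · intro k _ hk
      refine Subgroup.mem_iInf.2 fun n => ?_
      have := hnor _ (hN𝓝 n)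
      have := hcl _ (hN𝓝 n)
      refine (QuotientGroup.eq_one_iff k).1 (map_eq_one_of_neBot
        (r := QuotientGroup.mk' (N n)) QuotientGroup.continuous_mk ?_ ?_ hk)
      · rw [QuotientGroup.ker_mk']
        exact iInf_le N n
      · exact (iInf_le _ n).trans (comap_mk_nhds_one (N n)).ge
  · intro N hN hN𝓝 x hx
    obtain ⟨z, hz⟩ := h.complete _ (hanti N hN) (fun n => (hN𝓝 n).1) x
      fun k n hkn => (le_sup_left : N k ≤ N k ⊔ K) (hx k n hkn)
    obtain ⟨k, -, hk⟩ := exists_mem_forall_inv_mul_mem hK hN (fun n => hcl _ (hN𝓝 n))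
      (fun n => hx n (n + 1) n.lt_succ_self) (z := z) fun n => by
        obtain ⟨y, hy, k, hk, hyk⟩ := Subgroup.mem_sup_of_normal_right.1 (hz n)
        exact ⟨k⁻¹, K.inv_mem hk, by simpa [← hyk] using hy⟩
    exact ⟨z * k, fun n => by simpa [mul_assoc] using hk n⟩

/-- The quotient by a member `N = A ⊓ M` of the lifted lattice embeds in the product of `G ⧸ M` and
a second-countable group. -/
theorem IsKernelLattice.inheritedFromProd {K : Subgroup G} [K.Normal]
    (hK : IsCompact (K : Set G)) {𝓜 : Set (Subgroup G)} (h : IsKernelLattice K 𝓜)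
    {P : ∀ (Y : Type u) [TopologicalSpace Y], Prop} (hP : InheritedFromProd P)
    (hP𝓜 : ∀ M ∈ 𝓜, P (G ⧸ M)) {N : Subgroup G} (hN : N ∈ liftedKernels K 𝓜) :
    P (G ⧸ N) := by
  obtain ⟨hM, A, hA, hNA⟩ := hN
  have := hA.normal
  have hMn := h.normal _ hM
  have hMc := h.isClosed _ hM
  have hNn : N.Normal := by
    rw [hNA]
    infer_instance
  obtain ⟨Z, _, _, φ, _, _, _, hφ, rfl⟩ := hA
  have hNM : N ≤ N ⊔ K := le_sup_left
  have hNφ : N ≤ φ.ker := hNA.le.trans inf_le_left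
  let ψ : G →* (G ⧸ (N ⊔ K)) × Z := (QuotientGroup.mk' (N ⊔ K)).prod φ
  have hψ : comap ψ (𝓝 1) = 𝓝 1 * 𝓟 ((N ⊔ K : Subgroup G) : Set G) ⊓ comap φ (𝓝 1) := by
    rw [← comap_mk_nhds_one, show (1 : (G ⧸ (N ⊔ K)) × Z) = (1, 1) from rfl, nhds_prod_eq,
      Filter.prod_eq_inf, comap_inf, comap_comap, comap_comap]
    rfl
  have hψN : N ≤ ψ.ker := by
    rw [MonoidHom.ker_prod, QuotientGroup.ker_mk']
    exact le_inf hNM hNφ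
  refine hP _ _ Z _ (isInducing_lift N ψ hψN (le_antisymm ?_ ?_)) (hP𝓜 _ hM)
  · apply le_nhds_one_mul_of_isCompact hK
    · exact hψ.le.trans inf_le_left
    · intro k hk hne
      rw [hNA]
      exact ⟨map_eq_one_of_neBot hφ hNφ (hψ.le.trans inf_le_right) hne,
        (le_sup_right : K ≤ N ⊔ K) hk⟩
  · have hψc : Continuous ψ := QuotientGroup.continuous_mk.prodMk hφ
    intro s hs
    obtain ⟨W, hW, hWs⟩ := hs
    refine mem_nhds_one_mul_principal.2 ⟨ψ ⁻¹' W,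
      hψc.continuousAt.preimage_mem_nhds (by rwa [map_one]), ?_⟩
    rintro _ ⟨w, hw, n, hn, rfl⟩
    apply hWs
    have hn1 : ψ n = 1 := hψN hn
    simpa [hn1] using hw

end Lift

/-! ### Narrow groups and homomorphisms to second-countable groups -/

section Narrow

/-- A topological group is `ω`-narrow if it is covered by countably many translates of every
neighbourhood of the identity. -/
def IsOmegaNarrow (G : Type*) [Group G] [TopologicalSpace G] : Prop :=
  ∀ U ∈ 𝓝 (1 : G), ∃ C : Set G, C.Countable ∧ C * U = univ

variable {G : Type u} [Group G]

theorem IsOmegaNarrow.secondCountableTopology [TopologicalSpace G] [IsTopologicalGroup G]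
    (h : IsOmegaNarrow G) [(𝓝 (1 : G)).IsCountablyGenerated] : SecondCountableTopology G := by
  obtain ⟨W, hW⟩ := (𝓝 (1 : G)).exists_antitone_basis
  choose C hC hCW using fun n => h (W n) (hW.mem n)
  have hB := TopologicalSpace.isTopologicalBasis_of_isOpen_of_nhds
    (s := ⋃ n, (fun c => (fun g => c * g) '' interior (W n)) '' ⋃ m, C m) ?_ ?_
  · exact hB.secondCountableTopology
      (countable_iUnion fun n => (countable_iUnion hC).image _)
  · intro u hu
    obtain ⟨n, c, -, rfl⟩ := mem_iUnion.1 hu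
    exact isOpenMap_mul_left c _ isOpen_interior
  · intro g O hg hO
    have hgO : (fun x => g * x) ⁻¹' O ∈ 𝓝 (1 : G) :=
      (continuous_const_mul g).continuousAt.preimage_mem_nhds
        (hO.mem_nhds (by simpa using hg))
    obtain ⟨V, hV, -, hVinv, hVV⟩ := exists_closed_nhds_one_inv_eq_mul_subset hgO
    obtain ⟨n, -, hn⟩ := hW.1.mem_iff.1 hV
    obtain ⟨m, -, hm⟩ := hW.1.mem_iff.1 (interior_mem_nhds.2 (hW.mem n))
    obtain ⟨c, hc, w, hw, hcw⟩ : g ∈ C m * W m := hCW m ▸ mem_univ g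
    have hcw : c * w = g := hcw
    refine ⟨_, mem_iUnion.2 ⟨n, c, mem_iUnion.2 ⟨m, hc⟩, rfl⟩, ⟨w, hm hw, hcw⟩, ?_⟩
    rintro _ ⟨x, hx, rfl⟩
    have hwV : w⁻¹ ∈ V := by
      rw [← hVinv]
      simpa using hn (interior_subset (hm hw))
    have := hVV (mul_mem_mul hwV (hn (interior_subset hx)))
    simpa [← hcw, mul_assoc] using this

/-- In an `ω`-narrow group countably many neighbourhoods suffice to control all conjugates of a
given neighbourhood `V`. The same neighbourhoods take care of products and inverses. -/
theorem IsOmegaNarrow.exists_seq_conj_subset [TopologicalSpace G] [IsTopologicalGroup G]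
    (h : IsOmegaNarrow G) (V : Set G) (hV : V ∈ 𝓝 (1 : G)) :
    ∃ W : ℕ → Set G, (∀ n, W n ∈ 𝓝 (1 : G)) ∧ ∀ g : G, ∃ n,
      W n * W n ⊆ V ∧ W n ⊆ Inv.inv ⁻¹' V ∧ W n ⊆ (fun x => g * x * g⁻¹) ⁻¹' V := by
  obtain ⟨V', hV', -, hVi', hVV'⟩ := exists_closed_nhds_one_inv_eq_mul_subset hV
  obtain ⟨S, hS, -, hSi, hSS⟩ := exists_closed_nhds_one_inv_eq_mul_subset hV'
  have hSV' : S ⊆ V' := fun x hx => hSS ⟨x, hx, 1, mem_of_mem_nhds hS, mul_one x⟩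
  have hV'V : V' ⊆ V := fun x hx => hVV' ⟨x, hx, 1, mem_of_mem_nhds hV', mul_one x⟩
  obtain ⟨C, hC, hCS⟩ := h S hS
  have hCne : C.Nonempty := by
    obtain ⟨c, hc, -⟩ : (1 : G) ∈ C * S := hCS ▸ mem_univ _
    exact ⟨c, hc⟩
  obtain ⟨c, rfl⟩ := hC.exists_eq_range hCne
  refine ⟨fun n => S ∩ (fun x => (c n)⁻¹ * x * c n) ⁻¹' S, fun n => inter_mem hS ?_,
    fun g => ?_⟩
  · have : Continuous fun x : G => (c n)⁻¹ * x * c n := by fun_prop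
    exact this.continuousAt.preimage_mem_nhds (by simpa using hS)
  · obtain ⟨_, ⟨n, rfl⟩, s, hs, hg⟩ : g⁻¹ ∈ range c * S := hCS ▸ mem_univ _
    have hg : g = s⁻¹ * (c n)⁻¹ := by
      rw [← mul_inv_rev, inv_eq_iff_eq_inv.symm]
      exact hg.symm
    have hs' : s⁻¹ ∈ S := by
      rw [← hSi]
      simpa using hs
    refine ⟨n, ?_, ?_, ?_⟩
    · exact (mul_subset_mul inter_subset_left inter_subset_left).trans (hSS.trans hV'V)
    · intro x hx
      refine hV'V (hSV' ?_)
      rw [← hSi]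
      simpa using hx.1
    · intro x hx
      -- `g * x * g⁻¹ = s⁻¹ * (c⁻¹ * x * c) * s` is a product of three elements of `S`.
      have := hVV' (mul_mem_mul (hSS (mul_mem_mul hs' hx.2)) (hSV' hs))
      simpa [hg, mul_assoc] using this

/-- A second-countable group, Hausdorff or not, maps to its Hausdorff quotient by a homomorphism
whose kernel lies in every neighbourhood of the identity. -/
theorem exists_isSecondCountableKernel_of_secondCountableTopology [TopologicalSpace G]
    [IsTopologicalGroup G] [SecondCountableTopology G] :
    ∃ A : Subgroup G, IsSecondCountableKernel A ∧ ∀ U ∈ 𝓝 (1 : G), (A : Set G) ⊆ U := by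
  let φ : G →* SeparationQuotient G := SeparationQuotient.mkMonoidHom
  have hsc : SecondCountableTopology (SeparationQuotient G) :=
    SeparationQuotient.isQuotientMap_mk.secondCountableTopology SeparationQuotient.isOpenMap_mk
  refine ⟨φ.ker, ⟨SeparationQuotient G, inferInstance, inferInstance, φ, inferInstance,
    inferInstance, hsc, SeparationQuotient.continuous_mk, rfl⟩, fun U hU x hx => ?_⟩
  have hx1 : SeparationQuotient.mk x = SeparationQuotient.mk (1 : G) := hx
  have := SeparationQuotient.mk_eq_mk.1 hx1
  exact mem_of_mem_nhds (this.nhds_eq ▸ hU)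

/-- Every neighbourhood of the identity of an `ω`-narrow group contains the kernel of a continuous
homomorphism to a second-countable group (Guran's theorem). -/
theorem IsOmegaNarrow.exists_isSecondCountableKernel_subset [t : TopologicalSpace G]
    [IsTopologicalGroup G] (h : IsOmegaNarrow G) {U : Set G} (hU : U ∈ 𝓝 (1 : G)) :
    ∃ A : Subgroup G, IsSecondCountableKernel A ∧ (A : Set G) ⊆ U := by
  choose! W hW hWg using h.exists_seq_conj_subset
  -- Close `{U}` under the countably many operations `V ↦ W V n`.
  let τ : List ℕ → Set G := fun l => l.foldr (fun n V => W V n) U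
  have hτ : ∀ l, τ l ∈ 𝓝 (1 : G) := fun l => by
    induction l with
    | nil => exact hU
    | cons n l ih => exact hW _ ih n
  let ℱ : Filter G := ⨅ l, 𝓟 (τ l)
  have hℱ : 𝓝 (1 : G) ≤ ℱ := le_iInf fun l => le_principal_iff.2 (hτ l)
  have hτℱ : ∀ l, τ l ∈ ℱ := fun l => mem_iInf_of_mem l (mem_principal_self _)
  have hmul : Tendsto (fun x : G × G => x.1 * x.2) (ℱ ×ˢ ℱ) ℱ := by
    refine tendsto_iInf.2 fun l => tendsto_principal.2 ?_
    obtain ⟨n, hn, -⟩ := hWg (τ l) (hτ l) 1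
    filter_upwards [prod_mem_prod (hτℱ (n :: l)) (hτℱ (n :: l))] with x hx
    exact hn (mul_mem_mul hx.1 hx.2)
  have hinv : Tendsto (Inv.inv : G → G) ℱ ℱ := by
    refine tendsto_iInf.2 fun l => tendsto_principal.2 ?_
    obtain ⟨n, -, hn, -⟩ := hWg (τ l) (hτ l) 1
    exact mem_of_superset (hτℱ (n :: l)) hn
  have hconj : ∀ g : G, Tendsto (fun x => g * x * g⁻¹) ℱ ℱ := by
    refine fun g => tendsto_iInf.2 fun l => tendsto_principal.2 ?_
    obtain ⟨n, -, -, hn⟩ := hWg (τ l) (hτ l) g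
    exact mem_of_superset (hτℱ (n :: l)) hn
  let B : GroupFilterBasis G :=
    { ℱ.asBasis with
      one' := fun {V} hV => mem_of_mem_nhds (hℱ hV)
      mul' := fun {V} hV => by
        obtain ⟨V₁, hV₁, V₂, hV₂, hs⟩ := mem_prod_iff.1 (hmul hV)
        refine ⟨V₁ ∩ V₂, inter_mem hV₁ hV₂, ?_⟩
        rintro _ ⟨a, ha, b, hb, rfl⟩
        exact hs (mk_mem_prod ha.1 hb.2)
      inv' := fun {V} hV => ⟨_, hinv hV, Subset.rfl⟩
      conj' := fun g {V} hV => ⟨_, hconj g hV, Subset.rfl⟩ }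
  -- The topology of `B` is a coarser first-countable group topology on `G`.
  let t' : TopologicalSpace G := B.topology
  have hB : @nhds G t' 1 = ℱ := by
    rw [B.nhds_one_eq]
    exact ℱ.asBasis_filter
  have ht' : @IsTopologicalGroup G t' _ := B.isTopologicalGroup
  have hcg : (@nhds G t' 1).IsCountablyGenerated := by
    rw [hB]
    exact Filter.iInf.isCountablyGenerated fun l => 𝓟 (τ l)
  have hnar : @IsOmegaNarrow G _ t' := fun V hV => h V (hℱ (hB ▸ hV))
  have hsc : @SecondCountableTopology G t' :=
    @IsOmegaNarrow.secondCountableTopology G _ t' ht' hnar hcg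
  have hcont : Continuous[t, t'] (MonoidHom.id G) :=
    @continuous_of_continuousAt_one G t _ _ G _ _ t' _ _ _ (MonoidHom.id G) (by
      rw [@continuousAt_def]
      intro V hV
      rw [map_one, hB] at hV
      exact hℱ hV)
  obtain ⟨A, ⟨Z, _, _, φ, h₁, h₂, h₃, hφ, hA⟩, hAU⟩ :=
    @exists_isSecondCountableKernel_of_secondCountableTopology G _ t' ht' hsc
  refine ⟨A, ⟨Z, _, _, φ, h₁, h₂, h₃, ?_, hA⟩, hAU U ?_⟩
  · exact @Continuous.comp _ _ _ t t' _ _ _ hφ hcont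
  · rw [hB]
    exact hτℱ []

/-- A group with a compact normal subgroup `K` and a lattice of kernels modulo `K` is `ω`-narrow if
the corresponding quotients have countable networks. -/
theorem IsKernelLattice.isOmegaNarrow [TopologicalSpace G] [IsTopologicalGroup G]
    {K : Subgroup G} [K.Normal] (hK : IsCompact (K : Set G)) {𝓜 : Set (Subgroup G)}
    (h : IsKernelLattice K 𝓜) (h𝓜 : ∀ M ∈ 𝓜, HasCountableNetwork (G ⧸ M)) :
    IsOmegaNarrow G := by
  intro U hU
  obtain ⟨V, hVo, hV1, hVU⟩ := exists_open_nhds_one_mul_subset hU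
  obtain ⟨W, hWo, hW1, hWV⟩ := exists_open_nhds_one_mul_subset (hVo.mem_nhds hV1)
  have hWV' : W ⊆ V := fun x hx => hWV ⟨x, hx, 1, hW1, mul_one x⟩
  obtain ⟨M, hM, hMW⟩ := h.small W (hWo.mem_nhds hW1)
  obtain ⟨N, hN, hNet⟩ := h𝓜 M hM
  obtain ⟨F, -, hF⟩ := hK.elim_nhds_subcover (fun k => (fun x => k⁻¹ * x) ⁻¹' W) fun k _ =>
    (continuous_const_mul k⁻¹).continuousAt.preimage_mem_nhds
      (hWo.mem_nhds (by simpa using hW1))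
  -- For every member of the network that is small of order `W`, choose a translate containing it.
  let N' := {A ∈ N | ∃ g : G, A ⊆ QuotientGroup.mk '' ((fun x => g * x) '' W)}
  have hg : ∀ A ∈ N', ∃ g : G, A ⊆ QuotientGroup.mk '' ((fun x => g * x) '' W) :=
    fun A hA => hA.2
  choose! γ hγ using hg
  refine ⟨(γ '' N') * F, ((hN.mono (sep_subset _ _)).image γ).image2 F.countable_toSet _,
    eq_univ_of_forall fun x => ?_⟩
  have hO : IsOpen ((QuotientGroup.mk : G → G ⧸ M) '' ((fun y => x * y) '' W)) :=
    QuotientGroup.isOpenMap_coe _ (isOpenMap_mul_left x W hWo)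
  obtain ⟨A, hA, hxA, hAO⟩ := hNet _ (x : G ⧸ M) hO ⟨x, ⟨1, hW1, mul_one x⟩, rfl⟩
  have hA' : A ∈ N' := ⟨hA, x, hAO⟩
  obtain ⟨_, ⟨w, hw, rfl⟩, hwx⟩ := hγ A hA' hxA
  obtain ⟨w', hw', k, hk, hwk⟩ := hMW (QuotientGroup.eq.1 hwx)
  have hwk : w' * k = (γ A * w)⁻¹ * x := hwk
  -- Now `x = γ A * (w * w') * k`; normality moves the element of `K` in front of `w * w'`.
  have hkK : (w * w') * k * (w * w')⁻¹ ∈ K := ‹K.Normal›.conj_mem k hk _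
  obtain ⟨f, hf, hfk⟩ := mem_iUnion₂.1 (hF hkK)
  refine ⟨γ A * f, mul_mem_mul (mem_image_of_mem _ hA') hf,
    (f⁻¹ * ((w * w') * k * (w * w')⁻¹)) * (w * w'),
    hVU (mul_mem_mul (hWV' hfk) (hWV (mul_mem_mul hw hw'))), ?_⟩
  have hx : x = γ A * w * (w' * k) := by
    rw [hwk]
    group
  rw [hx]
  group

end Narrow

/-! ### The lifting theorem -/

/-- Lattices of open homomorphisms lift along a compact normal subgroup, for every property of the
targets that is inherited from products with second-countable spaces. -/
theorem HasStrongSigmaLatticeOfOpenHoms.of_quotient {G : Type u} [Group G] [TopologicalSpace G]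
    [IsTopologicalGroup G] {K : Subgroup G} [K.Normal] (hK : IsCompact (K : Set G))
    {P : ∀ (Y : Type u) [TopologicalSpace Y], Prop} (hP : InheritedFromProd P)
    (hPN : ∀ (Y : Type u) [TopologicalSpace Y], P Y → HasCountableNetwork Y)
    (h : HasStrongSigmaLatticeOfOpenHoms (G ⧸ K) P) : HasStrongSigmaLatticeOfOpenHoms G P := by
  obtain ⟨𝓜, h𝓜, hP𝓜⟩ := exists_isKernelLattice K hP h
  have hnar := h𝓜.isOmegaNarrow hK fun M hM => hPN _ (hP𝓜 M hM)
  exact (isKernelLattice_liftedKernels hK h𝓜 fun U hU =>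
    hnar.exists_isSecondCountableKernel_subset hU).hasStrongSigmaLatticeOfOpenHoms
    fun N hN => h𝓜.inheritedFromProd hK hP hP𝓜 hN

theorem mainTheorem3 (G : Type u) [Group G] [TopologicalSpace G] [IsTopologicalGroup G] [T2Space G]
    (K : Subgroup G) [K.Normal] (hK : IsCompact (K : Set G)) :
    (HasStrongSigmaLatticeOfOpenHoms (G ⧸ K) (fun Y _ => HasCountableNetwork Y) →
      HasStrongSigmaLatticeOfOpenHoms G (fun Y _ => HasCountableNetwork Y)) ∧
    (HasStrongSigmaLatticeOfOpenHoms (G ⧸ K) (fun Y _ => SecondCountableTopology Y) →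
      HasStrongSigmaLatticeOfOpenHoms G (fun Y _ => SecondCountableTopology Y)) :=
  ⟨.of_quotient hK inheritedFromProd_hasCountableNetwork fun _ _ => id,
    .of_quotient hK inheritedFromProd_secondCountableTopology fun Y _ _ =>
      hasCountableNetwork_of_secondCountableTopology Y⟩
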